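/- Let $d\ge 1$ be an integer and let $r$ be a prime number. Let $C_1,\ldots,C_{d+2}$ be pairwise disjoint sets in $\mathbb{R}^d$ (the color classes) with $|C_1|=\cdots=|C_{d+1}|=r-1$ and $|C_{d+2}|=1$. Call a subset $R\subseteq C_1\cup\cdots\cup C_{d+2}$ rainbow if $|R\cap C_j|\le 1$ for every $j=1,\ldots,d+2$. Then there are $r$ pairwise disjoint rainbow sets $R_1,\ldots,R_r$ (not required to cover $C_1\cup\cdots\cup C_{d+2}$) whose convex hulls have a common point, that is, $\bigcap_{i=1}^{r}\operatorname{conv}(R_i)\neq\emptyset$. -/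

import Mathlib

/-- A `BMZ-collection` in `ℝᵈ` for the parameter `r`: a `(d + 2)`-tuple of pairwise disjoint
sets, the first `d + 1` of which have exactly `r - 1` points, while the last one is a singleton.
(`Set.encard` is `ℕ∞`-valued, so all these sets are finite.) -/
structure IsBMZCollection (d r : ℕ) (C : Fin (d + 2) → Set (EuclideanSpace ℝ (Fin d))) :
    Prop where
  pairwise_disjoint : Pairwise (fun j k => Disjoint (C j) (C k))
  encard_castSucc : ∀ j : Fin (d + 1), (C j.castSucc).encard = ((r - 1 : ℕ) : ℕ∞)
  encard_last : (C (Fin.last (d + 1))).encard = 1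

/-- A set `R` is rainbow with respect to the color classes `C 0, …, C (k - 1)` if it is a subset
of their union which contains at most one point of each class. -/
def IsRainbow {E : Type*} {k : ℕ} (C : Fin k → Set E) (R : Set E) : Prop :=
  R ⊆ ⋃ j, C j ∧ ∀ j, (R ∩ C j).encard ≤ 1

/-- A rainbow `r`-partition: an ordered `r`-tuple of pairwise disjoint rainbow sets
(not required to cover all the points of the color classes). -/
def IsRainbowPartition {E : Type*} {k r : ℕ} (C : Fin k → Set E) (R : Fin r → Set E) : Prop :=
  (∀ i, IsRainbow C (R i)) ∧ Pairwise (fun i j => Disjoint (R i) (R j))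

/-- An `r`-tuple of sets is Tverberg if the convex hulls of all its members have a common
point. -/
def IsTverberg {E : Type*} [AddCommGroup E] [Module ℝ E] {r : ℕ} (R : Fin r → Set E) : Prop :=
  ∃ x : E, ∀ i, x ∈ convexHull ℝ (R i)

/-! Write `r = n + 1`. For each of the first `d + 1` colors `j` a permutation `π j` sends the `k`-th
point (`k ≠ 0`) to part `π j k`, while part `π j 0` gets no point of that color; the single point of
the last class, the apex, goes to part `0`. Write each homogenized point into the coordinates of its
part. A common point of the hulls is then a convex combination of these vectors that vanishes modulo
the vectors with equal components in all parts.

The families `π` are the facets of a join of chessboard complexes, an oriented pseudomanifold, and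
`configDegree` is the degree of the induced map: the signed number of cones containing minus the
apex. By the boundary identity `coneSign_cocycle`, moving the apex changes nothing, since each ridge
lies in two facets of opposite sign. Replacing a vector changes the degree by a sum invariant under
rotating the parts, hence by a multiple of `r` (`ShiftGeneric.configDegree_update`).

A concentrated configuration has degree `± n! ^ (d + 1)` (`eventually_configDegree_concentrated`),
nonzero modulo the prime `r`. So every generic configuration has a cone containing minus its apex,
and compactness extends the conclusion to all configurations. -/

open Matrix Filter Topology

/-! ### The cocycle identity for signed cones -/

/-- The pencil `b + τ a` is negative on `S` at its positive root in direction `p`. -/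
def PencilRoot {ι : Type*} (S : Finset ι) (a b : ι → ℝ) (p : ι) : Prop :=
  b p / a p < 0 ∧ ∀ q ∈ S, q ≠ p → b q - b p / a p * a q < 0

theorem PencilRoot.swap {ι : Type*} {S : Finset ι} {a b : ι → ℝ} {p : ι}
    (h : PencilRoot S a b p) : PencilRoot S b a p := by
  obtain ⟨h1, h2⟩ := h
  have ha : a p ≠ 0 := by rintro h; simp [h] at h1
  have hb : b p ≠ 0 := by rintro h; simp [h] at h1
  have h3 : a p / b p < 0 := by rw [← inv_div]; exact inv_lt_zero.2 h1
  refine ⟨h3, fun q hq hqp => ?_⟩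
  have h4 := mul_pos_of_neg_of_neg (h2 q hq hqp) h3
  have : (b q - b p / a p * a q) * (a p / b p) = - (a q - a p / b p * b q) := by
    field_simp; ring
  linarith

/-- Some member of the open pencil spanned by `a` and `b` is negative on `S`. -/
def PencilNeg {ι : Type*} (S : Finset ι) (a b : ι → ℝ) : Prop :=
  ∃ τ : ℝ, 0 < τ ∧ ∀ q ∈ S, b q + τ * a q < 0

theorem PencilNeg.swap {ι : Type*} {S : Finset ι} {a b : ι → ℝ}
    (h : PencilNeg S a b) : PencilNeg S b a := by
  obtain ⟨τ, h0, h⟩ := h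
  refine ⟨τ⁻¹, inv_pos.2 h0, fun q hq => ?_⟩
  have := mul_neg_of_neg_of_pos (h q hq) (inv_pos.2 h0)
  have e : (b q + τ * a q) * τ⁻¹ = a q + τ⁻¹ * b q := by field_simp; ring
  linarith

theorem pencilNeg_of_neg {ι : Type*} {S : Finset ι} {a b : ι → ℝ}
    (h : ∀ q ∈ S, b q < 0) : PencilNeg S a b := by
  have h1 : ∀ᶠ τ in 𝓝[>] (0 : ℝ), ∀ q ∈ S, b q + τ * a q < 0 := by
    refine (Finset.eventually_all S).2 fun q hq => nhdsWithin_le_nhds ?_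
    have : Tendsto (fun τ : ℝ => b q + τ * a q) (𝓝 0) (𝓝 (b q + 0 * a q)) := by
      apply Continuous.tendsto; fun_prop
    exact this.eventually (Iio_mem_nhds (by simpa using h q hq))
  obtain ⟨τ, h2, h3⟩ := (h1.and self_mem_nhdsWithin).exists
  exact ⟨τ, h3, h2⟩

/-- Just below the root the increasing coordinate `p` is negative, and the others stay negative by
continuity. -/
theorem PencilRoot.pencilNeg {ι : Type*} {S : Finset ι} {a b : ι → ℝ} {p : ι}
    (ha : 0 < a p) (h : PencilRoot S a b p) : PencilNeg S a b := by
  obtain ⟨h1, h2⟩ := h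
  set t := - (b p / a p) with ht
  have htp : 0 < t := by linarith
  have hroot : b p + t * a p = 0 := by rw [ht]; field_simp; ring
  have h3 : ∀ᶠ τ in 𝓝[<] t, 0 < τ ∧ ∀ q ∈ S, b q + τ * a q < 0 := by
    refine Filter.Eventually.and (nhdsWithin_le_nhds (Ioi_mem_nhds htp))
      ((Finset.eventually_all S).2 fun q hq => ?_)
    by_cases hqp : q = p
    · subst hqp
      filter_upwards [self_mem_nhdsWithin] with τ hτ
      have := mul_lt_mul_of_pos_right (show τ < t from hτ) ha
      linarith
    · have : Tendsto (fun τ : ℝ => b q + τ * a q) (𝓝 t) (𝓝 (b q + t * a q)) := by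
        apply Continuous.tendsto; fun_prop
      refine nhdsWithin_le_nhds (this.eventually (Iio_mem_nhds ?_))
      have := h2 q hq hqp
      rw [ht]; linarith
  obtain ⟨τ, h4⟩ := h3.exists
  exact ⟨τ, h4⟩

/-- As `τ` grows, negativity ends at the earliest root among the coordinates with `0 < a p`; `hab`
excludes ties. -/
theorem PencilNeg.exists_pencilRoot {ι : Type*} {S : Finset ι} {a b : ι → ℝ}
    (hab : ∀ p ∈ S, ∀ q ∈ S, p ≠ q → a p * b q - a q * b p ≠ 0)
    (h : PencilNeg S a b) (hU : ∃ p ∈ S, 0 < a p) :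
    ∃ p ∈ S, 0 < a p ∧ PencilRoot S a b p := by
  obtain ⟨τ, h0, h⟩ := h
  obtain ⟨p, hp, hmin⟩ := (S.filter (fun p => 0 < a p)).exists_min_image
    (fun p => - (b p / a p)) (by obtain ⟨p, hp⟩ := hU; exact ⟨p, by simpa using hp⟩)
  simp only [Finset.mem_filter] at hp hmin
  obtain ⟨hpS, hap⟩ := hp
  have hτ : b p / a p < -τ := by
    rw [div_lt_iff₀ hap]; linarith [h p hpS]
  refine ⟨p, hpS, hap, by linarith, fun q hq hqp => ?_⟩
  rcases lt_or_ge 0 (a q) with haq | haq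
  · have h1 := hmin q ⟨hq, haq⟩
    have h2 : b q - b p / a p * a q ≤ 0 := by
      have : b q / a q ≤ b p / a p := by linarith
      rw [div_le_iff₀ haq] at this
      linarith
    refine lt_of_le_of_ne h2 fun h3 => hab p hpS q hq hqp.symm ?_
    have : a p * (b q - b p / a p * a q) = a p * b q - a q * b p := by field_simp
    rw [← this, h3, mul_zero]
  · have := mul_nonneg_of_nonpos_of_nonpos haq (show b p / a p + τ ≤ 0 by linarith)
    linarith [h q hq]

theorem PencilRoot.unique {ι : Type*} {S : Finset ι} {a b : ι → ℝ} {p q : ι}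
    (hp : p ∈ S) (hq : q ∈ S) (hap : 0 < a p) (haq : 0 < a q)
    (h : PencilRoot S a b p) (h' : PencilRoot S a b q) : p = q := by
  by_contra hpq
  have h1 := h.2 q hq (Ne.symm hpq)
  have h2 := h'.2 p hp hpq
  have h3 : b q / a q < b p / a p := by rw [div_lt_iff₀ haq]; linarith
  have h4 : b p / a p < b q / a q := by rw [div_lt_iff₀ hap]; linarith
  linarith

-- The `τ > 0` at which the pencil is negative form an interval, and a root with `0 < a p` is its
-- right end. It exists exactly when the interval is nonempty and bounded.
open Classical in
theorem sum_pencilRoot {ι : Type*} {S : Finset ι} {a b : ι → ℝ}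
    (hab : ∀ p ∈ S, ∀ q ∈ S, p ≠ q → a p * b q - a q * b p ≠ 0) (ha : ∀ p ∈ S, a p ≠ 0) :
    (∑ p ∈ S, if 0 < a p ∧ PencilRoot S a b p then (1 : ℤ) else 0) =
      if PencilNeg S a b ∧ ¬ ∀ p ∈ S, a p < 0 then 1 else 0 := by
  by_cases h : ∃ p ∈ S, 0 < a p ∧ PencilRoot S a b p
  · obtain ⟨p, hp, hap, hr⟩ := h
    rw [if_pos ⟨hr.pencilNeg hap, fun h => lt_asymm (h p hp) hap⟩,
      Finset.sum_eq_single_of_mem p hp, if_pos ⟨hap, hr⟩]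
    intro q hq hqp
    exact if_neg fun h => hqp (h.2.unique hq hp h.1 hap hr)
  · rw [if_neg, Finset.sum_eq_zero]
    · intro p hp
      exact if_neg fun h1 => h ⟨p, hp, h1⟩
    · rintro ⟨h1, h2⟩
      push Not at h2
      obtain ⟨p, hp, h3⟩ := h2
      exact h (h1.exists_pencilRoot hab ⟨p, hp, lt_of_le_of_ne h3 (ha p hp).symm⟩)

-- Roots with `0 < a p` are right ends of the negativity interval. Those with `a p < 0` are left
-- ends, which become right ends when `a` and `b` are exchanged. A nonempty interval lacks a right
-- end iff `a` is negative on `S`, and a left end iff `b` is.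
open Classical in
theorem indicator_neg_eq_add_sum {ι : Type*} {S : Finset ι} {a b : ι → ℝ}
    (ha : ∀ p ∈ S, a p ≠ 0) (hb : ∀ p ∈ S, b p ≠ 0)
    (hab : ∀ p ∈ S, ∀ q ∈ S, p ≠ q → a p * b q - a q * b p ≠ 0) :
    (if ∀ p ∈ S, b p < 0 then (1 : ℤ) else 0) = (if ∀ p ∈ S, a p < 0 then 1 else 0) +
      ∑ p ∈ S, if PencilRoot S a b p then (SignType.sign (a p) : ℤ) else 0 := by
  have h1 := sum_pencilRoot hab ha
  have h2 := sum_pencilRoot (a := b) (b := a)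
    (fun p hp q hq h => by have := hab q hq p hp h.symm; convert this using 1; ring) hb
  have h3 : (∑ p ∈ S, if PencilRoot S a b p then (SignType.sign (a p) : ℤ) else 0) =
      (∑ p ∈ S, if 0 < a p ∧ PencilRoot S a b p then (1 : ℤ) else 0) -
      ∑ p ∈ S, if 0 < b p ∧ PencilRoot S b a p then (1 : ℤ) else 0 := by
    rw [← Finset.sum_sub_distrib]
    refine Finset.sum_congr rfl fun p hp => ?_
    by_cases h : PencilRoot S a b p
    · have h' := h.swap
      rcases lt_or_gt_of_ne (ha p hp) with h4 | h4
      · have : 0 < b p := by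
          by_contra h5
          exact absurd h.1 (not_lt.2 (div_nonneg_of_nonpos (not_lt.1 h5) h4.le))
        simp [h, h', h4, this, h4.not_gt]
      · have : b p < 0 := by
          by_contra h5
          exact absurd h.1 (not_lt.2 (div_nonneg (not_lt.1 h5) h4.le))
        simp [h, h', h4, this.not_gt]
    · have h' : ¬ PencilRoot S b a p := fun h' => h h'.swap
      simp [h, h']
  rw [h3, h1, h2]
  by_cases hA : ∀ p ∈ S, a p < 0 <;> by_cases hB : ∀ p ∈ S, b p < 0
  · rw [if_pos hA, if_pos hB, if_neg (by tauto), if_neg (by tauto)]; rfl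
  · have := (pencilNeg_of_neg (b := a) (a := b) hA)
    rw [if_neg hB, if_pos hA, if_neg (by tauto), if_pos ⟨this, hB⟩]; rfl
  · have := (pencilNeg_of_neg (b := b) (a := a) hB)
    rw [if_pos hB, if_neg hA, if_pos ⟨this, hA⟩, if_neg (by tauto)]; rfl
  · by_cases h : PencilNeg S a b
    · rw [if_neg hB, if_neg hA, if_pos ⟨h, hA⟩, if_pos ⟨h.swap, hB⟩]; rfl
    · have : ¬ PencilNeg S b a := fun h' => h h'.swap
      rw [if_neg hB, if_neg hA, if_neg (by tauto), if_neg (by tauto)]; rfl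

/-! ### Signed cones of matrices -/

open Classical in
/-- The sign of `det M` if, modulo the rows outside `S`, the vector `-v` lies in the open cone
spanned by the rows of `M` in `S`, and `0` otherwise. -/
noncomputable def coneSign {ι : Type*} [Fintype ι] [DecidableEq ι] (S : Finset ι) (M : Matrix ι ι ℝ)
    (v : ι → ℝ) : ℤ :=
  if ∀ p ∈ S, M.det * (M.updateRow p v).det < 0 then (SignType.sign M.det : ℤ) else 0

theorem exists_eq_sum_smul_row {ι : Type*} [Fintype ι] [DecidableEq ι] {M : Matrix ι ι ℝ}
    (hM : M.det ≠ 0) (v : ι → ℝ) : ∃ c : ι → ℝ, v = ∑ k, c k • M k := by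
  refine ⟨v ᵥ* M⁻¹, ?_⟩
  have : v = (v ᵥ* M⁻¹) ᵥ* M := by
    rw [vecMul_vecMul, nonsing_inv_mul _ (isUnit_iff_ne_zero.2 hM), vecMul_one]
  conv_lhs => rw [this, vecMul_eq_sum]

-- Cramer's rule: replacing row `p` multiplies the determinant by `c p`.
open Classical in
theorem coneSign_eq_of_eq_sum {ι : Type*} [Fintype ι] [DecidableEq ι] (S : Finset ι) {M : Matrix ι ι ℝ}
    (hM : M.det ≠ 0) (c : ι → ℝ) :
    coneSign S M (∑ k, c k • M k) =
      if ∀ p ∈ S, c p < 0 then (SignType.sign M.det : ℤ) else 0 := by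
  unfold coneSign
  congr 1
  refine propext (forall₂_congr fun p _ => ?_)
  rw [det_updateRow_sum, smul_eq_mul, mul_left_comm, ← sq]
  have : 0 < M.det ^ 2 := by positivity
  constructor
  · intro h; by_contra h'; nlinarith
  · intro h; exact mul_neg_of_neg_of_pos h this

/-- The pivot step: new coordinates after exchanging `R p` for `∑ k, a k • R k`. -/
theorem sum_smul_eq_sum_smul_update {ι V : Type*} [Fintype ι] [DecidableEq ι] [AddCommGroup V]
    [Module ℝ V] (R : ι → V) (a b : ι → ℝ) {p : ι} (hp : a p ≠ 0) :
    ∑ k, b k • R k = ∑ k, (if k = p then b p / a p else b k - b p / a p * a k) •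
      Function.update R p (∑ k, a k • R k) k := by
  rw [Fintype.sum_eq_add_sum_compl p (fun k => (if k = p then _ else _) • _)]
  have h1 : ∀ k ∈ ({p}ᶜ : Finset ι), (if k = p then b p / a p else b k - b p / a p * a k) •
      Function.update R p (∑ k, a k • R k) k = b k • R k - (b p / a p) • a k • R k := by
    intro k hk
    have hk : k ≠ p := by simpa using hk
    rw [if_neg hk, Function.update_of_ne hk, sub_smul, mul_smul]
  rw [Finset.sum_congr rfl h1, Finset.sum_sub_distrib, if_pos rfl, Function.update_self,
    ← Finset.smul_sum, Fintype.sum_eq_add_sum_compl p (fun k => a k • R k),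
    Fintype.sum_eq_add_sum_compl p (fun k => b k • R k), smul_add, smul_smul,
    div_mul_cancel₀ _ hp]
  abel

/-- With `v`, `v'` expanded in the rows as `a`, `b`, this is `indicator_neg_eq_add_sum` times the
sign of `M.det`: pivoting at `p` multiplies the determinant by `a p` and makes all coefficients of
`v'` on `S` negative exactly when `PencilRoot S a b p`. -/
theorem coneSign_cocycle {ι : Type*} [Fintype ι] [DecidableEq ι] (S : Finset ι)
    {M : Matrix ι ι ℝ} {v v' : ι → ℝ} (hM : M.det ≠ 0)
    (hv : ∀ p ∈ S, (M.updateRow p v).det ≠ 0) (hv' : ∀ p ∈ S, (M.updateRow p v').det ≠ 0)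
    (hvv' : ∀ p ∈ S, ∀ q ∈ S, p ≠ q → ((M.updateRow p v).updateRow q v').det ≠ 0) :
    coneSign S M v' = coneSign S M v + ∑ p ∈ S, coneSign S (M.updateRow p v) v' := by
  classical
  obtain ⟨a, rfl⟩ := exists_eq_sum_smul_row hM v
  obtain ⟨b, rfl⟩ := exists_eq_sum_smul_row hM v'
  simp only [det_updateRow_sum, smul_eq_mul] at hv hv'
  have ha : ∀ p ∈ S, a p ≠ 0 := fun p hp => left_ne_zero_of_mul (hv p hp)
  have hb : ∀ p ∈ S, b p ≠ 0 := fun p hp => left_ne_zero_of_mul (hv' p hp)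
  have key : ∀ p ∈ S, ∑ k, b k • M k =
      ∑ k, (if k = p then b p / a p else b k - b p / a p * a k) •
        (M.updateRow p (∑ k, a k • M k)) k := by
    intro p hp
    exact sum_smul_eq_sum_smul_update M a b (ha p hp)
  have hab : ∀ p ∈ S, ∀ q ∈ S, p ≠ q → a p * b q - a q * b p ≠ 0 := by
    intro p hp q hq hpq h
    apply hvv' p hp q hq hpq
    rw [key p hp, det_updateRow_sum, if_neg hpq.symm]
    have h0 := ha p hp
    have : b q - b p / a p * a q = (a p * b q - a q * b p) / a p := by field_simp
    rw [this, h, zero_div, zero_smul]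
  have hsum : ∀ p ∈ S, coneSign S (M.updateRow p (∑ k, a k • M k)) (∑ k, b k • M k) =
      (SignType.sign M.det : ℤ) *
        if PencilRoot S a b p then (SignType.sign (a p) : ℤ) else 0 := by
    intro p hp
    have h0 : (M.updateRow p (∑ k, a k • M k)).det ≠ 0 := by
      rw [det_updateRow_sum]; exact hv p hp
    have h1 := coneSign_eq_of_eq_sum S h0
      (fun k => if k = p then b p / a p else b k - b p / a p * a k)
    rw [← key p hp, det_updateRow_sum, smul_eq_mul, sign_mul] at h1
    rw [h1, mul_ite, mul_zero]
    have hiff : (∀ q ∈ S, (if q = p then b p / a p else b q - b p / a p * a q) < 0) ↔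
        PencilRoot S a b p := by
      refine ⟨fun h => ⟨by simpa using h p hp, fun q hq hqp => ?_⟩, fun h q hq => ?_⟩
      · simpa [hqp] using h q hq
      · split_ifs with hqp
        · exact h.1
        · exact h.2 q hq hqp
    rw [if_congr hiff rfl rfl]
    push_cast
    rw [mul_comm]
  rw [Finset.sum_congr rfl hsum, ← Finset.mul_sum, coneSign_eq_of_eq_sum S hM,
    coneSign_eq_of_eq_sum S hM]
  have := congrArg ((SignType.sign M.det : ℤ) * ·) (indicator_neg_eq_add_sum ha hb hab)
  simpa [mul_add, mul_ite] using this

/-! ### Configurations with cyclic symmetry and their degree -/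

/-- Cyclic shift of the second coordinate. -/
def cyclicShift {m n : ℕ} (i : Fin (n + 1)) (x : Fin m × Fin (n + 1) → ℝ) :
    Fin m × Fin (n + 1) → ℝ :=
  fun q => x (q.1, q.2 - i)

theorem cyclicShift_zero {m n : ℕ} (x : Fin m × Fin (n + 1) → ℝ) : cyclicShift 0 x = x := by
  funext q; simp [cyclicShift]

/-- The indicator function of the block `j`. -/
def blockIndicator {m n : ℕ} (j : Fin m) : Fin m × Fin (n + 1) → ℝ :=
  fun q => if q.1 = j then 1 else 0

/-- The matrix whose row `(j, 0)` is the indicator of the block `j`, and whose other rows `q`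
are the vectors `x q`, shifted by `s q`. -/
def configMatrix {m n : ℕ} (s : Fin m × Fin (n + 1) → Fin (n + 1))
    (x : Fin m × Fin (n + 1) → Fin m × Fin (n + 1) → ℝ) :
    Matrix (Fin m × Fin (n + 1)) (Fin m × Fin (n + 1)) ℝ :=
  Matrix.of fun q => if q.2 = 0 then blockIndicator q.1 else cyclicShift (s q) (x q)

/-- The indices of the rows of `configMatrix` that depend on the configuration. -/
def freeRows (m n : ℕ) : Finset (Fin m × Fin (n + 1)) :=
  Finset.univ.filter fun q => q.2 ≠ 0

@[simp] theorem mem_freeRows {m n : ℕ} {q : Fin m × Fin (n + 1)} :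
    q ∈ freeRows m n ↔ q.2 ≠ 0 := by
  simp [freeRows]

theorem updateRow_configMatrix {m n : ℕ} (s : Fin m × Fin (n + 1) → Fin (n + 1))
    (x : Fin m × Fin (n + 1) → Fin m × Fin (n + 1) → ℝ) {p : Fin m × Fin (n + 1)}
    (hp : p.2 ≠ 0) (i : Fin (n + 1)) (v : Fin m × Fin (n + 1) → ℝ) :
    (configMatrix s x).updateRow p (cyclicShift i v) =
      configMatrix (Function.update s p i) (Function.update x p v) := by
  ext q k
  by_cases h : q = p
  · subst h; simp [configMatrix, hp]
  · simp [configMatrix, h]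

/-- The shifts given by a family of permutations. -/
def permShift {m n : ℕ} (π : Fin m → Equiv.Perm (Fin (n + 1))) :
    Fin m × Fin (n + 1) → Fin (n + 1) :=
  fun q => π q.1 q.2

/-- The product of the signs of a family of permutations. -/
def permSign {m n : ℕ} (π : Fin m → Equiv.Perm (Fin (n + 1))) : ℤ :=
  ((∏ j, Equiv.Perm.sign (π j) : ℤˣ) : ℤ)

/-- The signed number of simplices of the join of chessboard complexes whose cone with apex `v`
contains the origin. -/
noncomputable def configDegree {m n : ℕ} (x : Fin m × Fin (n + 1) → Fin m × Fin (n + 1) → ℝ)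
    (v : Fin m × Fin (n + 1) → ℝ) : ℤ :=
  ∑ π : Fin m → Equiv.Perm (Fin (n + 1)),
    permSign π * coneSign (freeRows m n) (configMatrix (permShift π) x) v

/-- Exchange the value at `p` with the value at `0` of the same block. -/
def swapAt {m n : ℕ} (p : Fin m × Fin (n + 1)) (π : Fin m → Equiv.Perm (Fin (n + 1))) :
    Fin m → Equiv.Perm (Fin (n + 1)) :=
  π * Pi.mulSingle p.1 (Equiv.swap p.2 0)

theorem permSign_swapAt {m n : ℕ} {p : Fin m × Fin (n + 1)} (hp : p.2 ≠ 0)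
    (π : Fin m → Equiv.Perm (Fin (n + 1))) : permSign (swapAt p π) = - permSign π := by
  have : ∏ j, Equiv.Perm.sign
      ((Pi.mulSingle p.1 (Equiv.swap p.2 0) : Fin m → Equiv.Perm (Fin (n + 1))) j) = -1 := by
    rw [Finset.prod_eq_single_of_mem p.1 (Finset.mem_univ _)]
    · rw [Pi.mulSingle_eq_same, Equiv.Perm.sign_swap hp]
    · intro j _ hj
      rw [Pi.mulSingle_eq_of_ne hj, map_one]
  simp only [permSign, swapAt, Pi.mul_apply, map_mul, Finset.prod_mul_distrib, this]
  simp

theorem permShift_swapAt {m n : ℕ} {p q : Fin m × Fin (n + 1)} (hqp : q ≠ p) (hq : q.2 ≠ 0)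
    (π : Fin m → Equiv.Perm (Fin (n + 1))) : permShift (swapAt p π) q = permShift π q := by
  simp only [permShift, swapAt, Pi.mul_apply, Equiv.Perm.mul_apply]
  congr 1
  by_cases h : q.1 = p.1
  · rw [h, Pi.mulSingle_eq_same]
    exact Equiv.swap_apply_of_ne_of_ne (fun h' => hqp (Prod.ext h h')) hq
  · rw [Pi.mulSingle_eq_of_ne h]; rfl

/-- The two facets sharing the ridge opposite `p` are `π` and `swapAt p π`; their signs are
opposite, so they cancel. -/
theorem sum_permSign_mul_eq_zero {m n : ℕ} {p : Fin m × Fin (n + 1)} (hp : p.2 ≠ 0)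
    (h : (Fin m → Equiv.Perm (Fin (n + 1))) → ℤ) (hh : ∀ π, h (swapAt p π) = h π) :
    ∑ π, permSign π * h π = 0 := by
  have h1 : ∑ π, permSign π * h π = ∑ π, permSign (swapAt p π) * h (swapAt p π) :=
    (Equiv.sum_comp (Equiv.mulRight (Pi.mulSingle p.1 (Equiv.swap p.2 0) :
      Fin m → Equiv.Perm (Fin (n + 1)))) fun π => permSign π * h π).symm
  simp only [permSign_swapAt hp, hh, neg_mul, Finset.sum_neg_distrib] at h1
  omega

theorem updateRow_configMatrix_swapAt {m n : ℕ} {p : Fin m × Fin (n + 1)}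
    (π : Fin m → Equiv.Perm (Fin (n + 1)))
    (x : Fin m × Fin (n + 1) → Fin m × Fin (n + 1) → ℝ) (v : Fin m × Fin (n + 1) → ℝ) :
    (configMatrix (permShift (swapAt p π)) x).updateRow p v =
      (configMatrix (permShift π) x).updateRow p v := by
  ext q k
  by_cases h : q = p
  · subst h; simp
  · rw [updateRow_ne h, updateRow_ne h]
    by_cases h0 : q.2 = 0
    · simp [configMatrix, h0]
    · simp [configMatrix, h0, permShift_swapAt h h0]

/-! ### Generic families and invariance of the degree -/

/-- Every choice of distinct vectors of the family, with arbitrary shifts, is linearly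
independent modulo the indicators of the blocks. -/
def ShiftGeneric {m n : ℕ} {Λ : Type*} (x : Λ → Fin m × Fin (n + 1) → ℝ) : Prop :=
  ∀ ℓ : Fin m × Fin (n + 1) → Λ, Function.Injective ℓ → ∀ s : Fin m × Fin (n + 1) → Fin (n + 1),
    (configMatrix s (x ∘ ℓ)).det ≠ 0

theorem injective_update {α β : Type*} [DecidableEq α] {ℓ : α → β} (hℓ : Function.Injective ℓ)
    {a : β} (ha : a ∉ Set.range ℓ) (p : α) : Function.Injective (Function.update ℓ p a) := by
  intro q q' h
  by_cases h1 : q = p <;> by_cases h2 : q' = p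
  · rw [h1, h2]
  · subst h1
    simp only [Function.update_self, Function.update_of_ne h2] at h
    exact absurd ⟨q', h.symm⟩ ha
  · subst h2
    simp only [Function.update_self, Function.update_of_ne h1] at h
    exact absurd ⟨q, h⟩ ha
  · simp only [Function.update_of_ne h1, Function.update_of_ne h2] at h
    exact hℓ h

theorem ShiftGeneric.cocycle {m n : ℕ} {Λ : Type*} {x : Λ → Fin m × Fin (n + 1) → ℝ}
    (hx : ShiftGeneric x) {ℓ : Fin m × Fin (n + 1) → Λ} (hℓ : Function.Injective ℓ) {a b : Λ}
    (ha : a ∉ Set.range ℓ) (hb : b ∉ Set.range ℓ) (hab : a ≠ b)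
    (s : Fin m × Fin (n + 1) → Fin (n + 1)) (i k : Fin (n + 1)) :
    coneSign (freeRows m n) (configMatrix s (x ∘ ℓ)) (cyclicShift k (x b)) =
      coneSign (freeRows m n) (configMatrix s (x ∘ ℓ)) (cyclicShift i (x a)) +
      ∑ p ∈ freeRows m n,
        coneSign (freeRows m n) ((configMatrix s (x ∘ ℓ)).updateRow p (cyclicShift i (x a)))
          (cyclicShift k (x b)) := by
  refine coneSign_cocycle _ (hx ℓ hℓ s) ?_ ?_ ?_
  · intro p hp
    rw [updateRow_configMatrix _ _ (mem_freeRows.1 hp), ← Function.comp_update]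
    exact hx _ (injective_update hℓ ha p) _
  · intro p hp
    rw [updateRow_configMatrix _ _ (mem_freeRows.1 hp), ← Function.comp_update]
    exact hx _ (injective_update hℓ hb p) _
  · intro p hp q hq _
    rw [updateRow_configMatrix _ _ (mem_freeRows.1 hp), ← Function.comp_update,
      updateRow_configMatrix _ _ (mem_freeRows.1 hq), ← Function.comp_update]
    refine hx _ (injective_update (injective_update hℓ ha p) ?_ q) _
    rintro ⟨q', h⟩
    by_cases h1 : q' = p
    · subst h1; rw [Function.update_self] at h; exact hab h
    · rw [Function.update_of_ne h1] at h; exact hb ⟨q', h⟩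

/-- In each correction term of the cocycle, row `p` is overwritten by a vector independent of `π`,
so the terms cancel across ridges. -/
theorem ShiftGeneric.configDegree_apex {m n : ℕ} {Λ : Type*} {x : Λ → Fin m × Fin (n + 1) → ℝ}
    (hx : ShiftGeneric x) {ℓ : Fin m × Fin (n + 1) → Λ} (hℓ : Function.Injective ℓ) {a b : Λ}
    (ha : a ∉ Set.range ℓ) (hb : b ∉ Set.range ℓ) (hab : a ≠ b) :
    configDegree (x ∘ ℓ) (x b) = configDegree (x ∘ ℓ) (x a) := by
  have h := fun s => hx.cocycle hℓ ha hb hab s 0 0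
  simp only [cyclicShift_zero] at h
  simp only [configDegree, h, mul_add, Finset.sum_add_distrib, Finset.mul_sum]
  rw [Finset.sum_comm, Finset.sum_eq_zero (s := freeRows m n), add_zero]
  intro p hp
  refine sum_permSign_mul_eq_zero (mem_freeRows.1 hp) _ fun π => ?_
  rw [updateRow_configMatrix_swapAt]

/-- Shift all values of a family of permutations. -/
def shiftAll {m n : ℕ} (i : Fin (n + 1)) (π : Fin m → Equiv.Perm (Fin (n + 1))) :
    Fin m → Equiv.Perm (Fin (n + 1)) :=
  (fun _ => Equiv.addLeft i) * π

theorem coneSign_submatrix {ι : Type*} [Fintype ι] [DecidableEq ι] (S : Finset ι)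
    (M : Matrix ι ι ℝ) (v : ι → ℝ) (σ : Equiv.Perm ι) :
    coneSign S (M.submatrix id σ) (v ∘ σ) = (Equiv.Perm.sign σ : ℤ) * coneSign S M v := by
  have h : ∀ p, (M.submatrix id σ).updateRow p (v ∘ σ) = (M.updateRow p v).submatrix id σ := by
    intro p
    ext q k
    by_cases hq : q = p
    · subst hq; simp
    · simp [updateRow_ne hq]
  unfold coneSign
  simp only [h, det_permute']
  rcases Int.units_eq_one_or (Equiv.Perm.sign σ) with h1 | h1
  · simp [h1]
  · simp [h1, Left.sign_neg]

/-- Rotating the parts permutes the columns inside each block; the sign of this column permutation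
is also the factor gained by `permSign`. -/
theorem permSign_mul_coneSign_shiftAll {m n : ℕ}
    (x : Fin m × Fin (n + 1) → Fin m × Fin (n + 1) → ℝ) (v : Fin m × Fin (n + 1) → ℝ)
    (p : Fin m × Fin (n + 1)) (i : Fin (n + 1)) (π : Fin m → Equiv.Perm (Fin (n + 1))) :
    permSign (shiftAll i π) * coneSign (freeRows m n) (configMatrix (permShift (shiftAll i π)) x)
        (cyclicShift (permShift (shiftAll i π) p) v) =
      permSign π * coneSign (freeRows m n) (configMatrix (permShift π) x)
        (cyclicShift (permShift π p) v) := by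
  set σ : Equiv.Perm (Fin m × Fin (n + 1)) :=
    Equiv.prodCongrRight fun _ => Equiv.addLeft (-i) with hσ
  have hshift : ∀ (k : Fin (n + 1)) (w : Fin m × Fin (n + 1) → ℝ),
      cyclicShift (i + k) w = cyclicShift k w ∘ σ := by
    intro k w
    funext ⟨j, l⟩
    change w (j, l - (i + k)) = w (j, -i + l - k)
    congr 2
    abel
  have hM : configMatrix (permShift (shiftAll i π)) x =
      (configMatrix (permShift π) x).submatrix id σ := by
    ext q k
    by_cases h0 : q.2 = 0
    · simp [configMatrix, h0, blockIndicator, hσ]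
    · simp only [configMatrix, of_apply, if_neg h0, submatrix_apply, id]
      exact congrFun (hshift _ _) k
  have hv : cyclicShift (permShift (shiftAll i π) p) v = cyclicShift (permShift π p) v ∘ σ :=
    hshift _ _
  have hs : permSign (shiftAll i π) = (Equiv.Perm.sign σ : ℤ) * permSign π := by
    have h1 : (Equiv.addLeft (-i) : Equiv.Perm (Fin (n + 1))) = (Equiv.addLeft i)⁻¹ := by
      ext k; simp [Equiv.Perm.inv_def]
    simp only [permSign, shiftAll, Pi.mul_apply, map_mul, Finset.prod_mul_distrib, hσ,
      Equiv.Perm.sign_prodCongrRight, h1, Equiv.Perm.sign_inv]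
    push_cast
    rfl
  rw [hM, hv, hs, coneSign_submatrix]
  rcases Int.units_eq_one_or (Equiv.Perm.sign σ) with h1 | h1 <;> simp [h1]

theorem shiftAll_shiftAll {m n : ℕ} {k l : Fin (n + 1)} (hkl : k + l = 0)
    (π : Fin m → Equiv.Perm (Fin (n + 1))) : shiftAll k (shiftAll l π) = π := by
  refine funext fun j => Equiv.ext fun t => ?_
  simp only [shiftAll, Pi.mul_apply, Equiv.Perm.mul_apply, Equiv.coe_addLeft]
  rw [← add_assoc, hkl, zero_add]

theorem shiftAll_apply {m n : ℕ} (k : Fin (n + 1)) (π : Fin m → Equiv.Perm (Fin (n + 1)))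
    (j : Fin m) (t : Fin (n + 1)) : shiftAll k π j t = k + π j t := by
  simp only [shiftAll, Pi.mul_apply, Equiv.Perm.mul_apply, Equiv.coe_addLeft]

/-- Rotation permutes the fibers of `π ↦ π 0 0` transitively, so all `n + 1` of them have the same
sum. -/
theorem dvd_sum_of_shiftAll_invariant {m n : ℕ}
    (F : (Fin (m + 1) → Equiv.Perm (Fin (n + 1))) → ℤ)
    (hF : ∀ i π, F (shiftAll i π) = F π) : ((n + 1 : ℕ) : ℤ) ∣ ∑ π, F π := by
  have h2 : ∀ i : Fin (n + 1),
      ∑ π : Fin (m + 1) → Equiv.Perm (Fin (n + 1)) with π 0 0 = i, F π =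
      ∑ π : Fin (m + 1) → Equiv.Perm (Fin (n + 1)) with π 0 0 = 0, F π := by
    intro i
    symm
    refine Finset.sum_nbij' (shiftAll i) (shiftAll (-i)) ?_ ?_ ?_ ?_ ?_
    · intro π hπ
      rw [Finset.mem_filter_univ] at hπ ⊢
      rw [shiftAll_apply, hπ, add_zero]
    · intro π hπ
      rw [Finset.mem_filter_univ] at hπ ⊢
      rw [shiftAll_apply, hπ, neg_add_cancel]
    · exact fun π _ => shiftAll_shiftAll (neg_add_cancel i) π
    · exact fun π _ => shiftAll_shiftAll (add_neg_cancel i) π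
    · exact fun π _ => (hF i π).symm
  rw [← Finset.sum_fiberwise Finset.univ (fun π => π 0 0) F,
    Finset.sum_congr rfl fun i _ => h2 i, Finset.sum_const, Finset.card_univ,
    Fintype.card_fin, nsmul_eq_mul]
  exact dvd_mul_right _ _

/-- In the cocycle, shift `x a` as `π` shifts row `p`. The term at `p` then gives the updated
configuration and the other terms cancel across ridges. What remains has an apex that rotates with
`π`, so it is invariant under `shiftAll`. -/
theorem ShiftGeneric.configDegree_update {m n : ℕ} {Λ : Type*}
    {x : Λ → Fin (m + 1) × Fin (n + 1) → ℝ}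
    (hx : ShiftGeneric x) {ℓ : Fin (m + 1) × Fin (n + 1) → Λ} (hℓ : Function.Injective ℓ) {a b : Λ}
    (ha : a ∉ Set.range ℓ) (hb : b ∉ Set.range ℓ) (hab : a ≠ b) (p : Fin (m + 1) × Fin (n + 1)) :
    ((n + 1 : ℕ) : ℤ) ∣ configDegree (x ∘ ℓ) (x b) -
      configDegree (x ∘ Function.update ℓ p a) (x b) := by
  -- Row `(j, 0)` is a block indicator and never sees the configuration.
  by_cases hp : p.2 = 0
  · have : ∀ s, configMatrix s (x ∘ Function.update ℓ p a) = configMatrix s (x ∘ ℓ) := by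
      intro s
      ext q k
      by_cases hq : q.2 = 0
      · simp [configMatrix, hq]
      · have : q ≠ p := by rintro rfl; exact hq hp
        simp [configMatrix, hq, Function.update_of_ne this]
    simp [configDegree, this]
  have h := fun π : Fin (m + 1) → Equiv.Perm (Fin (n + 1)) =>
    hx.cocycle hℓ ha hb hab (permShift π) (permShift π p) 0
  simp only [cyclicShift_zero, ← Finset.add_sum_erase _ _ (mem_freeRows.2 hp)] at h
  have h' : ∀ π : Fin (m + 1) → Equiv.Perm (Fin (n + 1)),
      (configMatrix (permShift π) (x ∘ ℓ)).updateRow p (cyclicShift (permShift π p) (x a)) =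
      configMatrix (permShift π) (x ∘ Function.update ℓ p a) := by
    intro π
    rw [updateRow_configMatrix _ _ hp, ← Function.comp_update, Function.update_eq_self]
  simp only [h'] at h
  have h0 : ∑ π : Fin (m + 1) → Equiv.Perm (Fin (n + 1)), permSign π *
      ∑ q ∈ (freeRows (m + 1) n).erase p, coneSign (freeRows (m + 1) n)
        ((configMatrix (permShift π) (x ∘ ℓ)).updateRow q (cyclicShift (permShift π p) (x a)))
        (x b) = 0 := by
    simp only [Finset.mul_sum]
    rw [Finset.sum_comm]
    refine Finset.sum_eq_zero fun q hq => ?_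
    rw [Finset.mem_erase, mem_freeRows] at hq
    refine sum_permSign_mul_eq_zero hq.2 _ fun π => ?_
    rw [updateRow_configMatrix_swapAt, permShift_swapAt hq.1.symm hp]
  have h1 : configDegree (x ∘ ℓ) (x b) - configDegree (x ∘ Function.update ℓ p a) (x b) =
      ∑ π : Fin (m + 1) → Equiv.Perm (Fin (n + 1)), permSign π *
        coneSign (freeRows (m + 1) n) (configMatrix (permShift π) (x ∘ ℓ))
          (cyclicShift (permShift π p) (x a)) := by
    simp only [configDegree, h, mul_add, Finset.sum_add_distrib, h0]
    ring
  rw [h1]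
  exact dvd_sum_of_shiftAll_invariant _ fun i π => permSign_mul_coneSign_shiftAll _ _ p i π

/-! ### The degree of a concentrated configuration -/

theorem cyclicShift_single {m n : ℕ} (i : Fin (n + 1)) (j : Fin m) :
    cyclicShift i (Pi.single (j, 0) 1) = Pi.single (j, i) (1 : ℝ) := by
  funext ⟨j', k⟩
  simp only [cyclicShift, Pi.single_apply, Prod.mk.injEq, sub_eq_zero]

/-- The configuration all of whose vectors in block `j` are equal to the basis vector `(j, 0)`. -/
def concentrated (m n : ℕ) : Fin m × Fin (n + 1) → Fin m × Fin (n + 1) → ℝ :=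
  fun q => Pi.single (q.1, 0) 1

/-- The sum of the basis vectors `(j, 0)`. -/
def concentratedApex (m n : ℕ) : Fin m × Fin (n + 1) → ℝ :=
  fun q => if q.2 = 0 then 1 else 0

/-- The free rows of block `j` are the basis vectors `(j, π j k)` with `k ≠ 0`; the block indicator
supplies the missing one. -/
theorem det_configMatrix_concentrated_ne_zero {m n : ℕ}
    (π : Fin m → Equiv.Perm (Fin (n + 1))) :
    (configMatrix (permShift π) (concentrated m n)).det ≠ 0 := by
  intro h
  obtain ⟨v, hv0, hv⟩ := exists_mulVec_eq_zero_iff.2 h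
  apply hv0
  have h1 : ∀ j, ∀ k ≠ 0, v (j, π j k) = 0 := by
    intro j k hk
    have := congrFun hv (j, k)
    simpa [mulVec, configMatrix, hk, concentrated, cyclicShift_single, permShift] using this
  funext ⟨j, l⟩
  obtain ⟨k, rfl⟩ := (π j).surjective l
  by_cases hk : k = 0
  · subst hk
    have := congrFun hv (j, 0)
    simp only [mulVec, dotProduct, configMatrix, of_apply, if_pos, blockIndicator,
      Pi.zero_apply, ite_mul, one_mul, zero_mul, Fintype.sum_prod_type] at this
    rw [Finset.sum_eq_single_of_mem j (Finset.mem_univ _) (fun j' _ hj => by simp [hj])] at this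
    simp only [if_true] at this
    rw [← Equiv.sum_comp (π j), Finset.sum_eq_single_of_mem 0 (Finset.mem_univ _)
      (fun k _ hk => h1 j k hk)] at this
    exact this
  · exact h1 j k hk

theorem configMatrix_concentrated_of_fix {m n : ℕ} {π : Fin m → Equiv.Perm (Fin (n + 1))}
    (hπ : ∀ j, π j 0 = 0) :
    configMatrix (permShift π) (concentrated m n) =
      (configMatrix (permShift 1) (concentrated m n)).submatrix (Equiv.prodCongrRight π) id := by
  ext ⟨j, k⟩ q
  have : Equiv.prodCongrRight π (j, k) = (j, π j k) := rfl
  by_cases hk : k = 0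
  · subst hk
    simp [configMatrix, this, hπ]
  · have h0 : π j k ≠ 0 := fun h => hk ((π j).injective (h.trans (hπ j).symm))
    simp [configMatrix, this, hk, h0, concentrated, cyclicShift_single, permShift]

/-- If `π j 0 = 0`, the basis vector `(j, 0)` is the block indicator minus all free rows of the
block; otherwise it is itself a free row. Hence the free coefficients are all negative if every `π
j` fixes `0`, and otherwise some free coefficient is positive. -/
theorem concentratedApex_eq_sum {m n : ℕ} (π : Fin m → Equiv.Perm (Fin (n + 1))) :
    concentratedApex m n = ∑ q : Fin m × Fin (n + 1),
      (if π q.1 0 = 0 then (if q.2 = 0 then 1 else -1) else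
        (if π q.1 q.2 = 0 then (1 : ℝ) else 0)) •
      configMatrix (permShift π) (concentrated m n) q := by
  funext ⟨j, l⟩
  rw [Finset.sum_apply, Fintype.sum_prod_type, Finset.sum_eq_single_of_mem j (Finset.mem_univ _)]
  · by_cases h : π j 0 = 0
    · rw [Fin.sum_univ_succ]
      obtain ⟨k, rfl⟩ := (π j).surjective l
      refine Fin.cases ?_ (fun k => ?_) k
      · have : ∀ i : Fin n, π j i.succ ≠ 0 := fun i hi =>
          Fin.succ_ne_zero i ((π j).injective (hi.trans h.symm))
        simp [configMatrix, h, blockIndicator, concentrated, cyclicShift_single, permShift,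
          concentratedApex, (this _).symm]
      · have : π j k.succ ≠ 0 := fun hi =>
          Fin.succ_ne_zero k ((π j).injective (hi.trans h.symm))
        simp [configMatrix, h, blockIndicator, concentrated, cyclicShift_single, permShift,
          concentratedApex, Pi.single_apply, this]
    · obtain ⟨k, hk⟩ := (π j).surjective 0
      have hk0 : k ≠ 0 := by rintro rfl; exact h hk
      rw [Finset.sum_eq_single_of_mem k (Finset.mem_univ _)]
      · simp [configMatrix, h, hk, hk0, concentrated, cyclicShift_single, permShift,
          concentratedApex, Pi.single_apply]
      · intro k' _ hk'
        have : π j k' ≠ 0 := fun h' => hk' ((π j).injective (h'.trans hk.symm))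
        simp [h, this]
  · intro j' _ hj
    refine Finset.sum_eq_zero fun k _ => ?_
    by_cases hk : k = 0 <;>
      simp [configMatrix, hk, blockIndicator, concentrated, cyclicShift_single, hj.symm]

theorem continuous_configMatrix {m n : ℕ} (s : Fin m × Fin (n + 1) → Fin (n + 1)) :
    Continuous (configMatrix (m := m) (n := n) s) := by
  refine continuous_matrix fun q k => ?_
  by_cases h : q.2 = 0
  · simp only [configMatrix, of_apply, if_pos h]; fun_prop
  · simp only [configMatrix, of_apply, if_neg h, cyclicShift]; fun_prop

theorem eventually_coneSign_of_neg {X ι : Type*} [TopologicalSpace X] [Fintype ι] [DecidableEq ι]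
    {S : Finset ι} {M : X → Matrix ι ι ℝ} {v : X → ι → ℝ} (hM : Continuous M) (hv : Continuous v)
    {z : X} (h0 : (M z).det ≠ 0) (h : ∀ p ∈ S, (M z).det * ((M z).updateRow p (v z)).det < 0) :
    ∀ᶠ y in 𝓝 z, coneSign S (M y) (v y) = (SignType.sign (M z).det : ℤ) := by
  have h1 : ∀ᶠ y in 𝓝 z, ∀ p ∈ S, (M y).det * ((M y).updateRow p (v y)).det < 0 := by
    refine (Finset.eventually_all S).2 fun p hp => ?_
    have : Continuous fun y => (M y).det * ((M y).updateRow p (v y)).det :=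
      hM.matrix_det.mul (hM.matrix_updateRow p hv).matrix_det
    exact this.tendsto z |>.eventually (Iio_mem_nhds (h p hp))
  have h2 : ∀ᶠ y in 𝓝 z, SignType.sign (M y).det = SignType.sign (M z).det := by
    rcases lt_or_gt_of_ne h0 with h3 | h3
    · filter_upwards [hM.matrix_det.tendsto z |>.eventually (Iio_mem_nhds h3)] with y hy
      rw [sign_neg h3, sign_neg hy]
    · filter_upwards [hM.matrix_det.tendsto z |>.eventually (Ioi_mem_nhds h3)] with y hy
      rw [sign_pos h3, sign_pos hy]
  filter_upwards [h1, h2] with y hy hy'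
  rw [coneSign, if_pos hy, hy']

theorem eventually_coneSign_of_pos {X ι : Type*} [TopologicalSpace X] [Fintype ι] [DecidableEq ι]
    {S : Finset ι} {M : X → Matrix ι ι ℝ} {v : X → ι → ℝ} (hM : Continuous M) (hv : Continuous v)
    {z : X} {p : ι} (hp : p ∈ S) (h : 0 < (M z).det * ((M z).updateRow p (v z)).det) :
    ∀ᶠ y in 𝓝 z, coneSign S (M y) (v y) = 0 := by
  have : Continuous fun y => (M y).det * ((M y).updateRow p (v y)).det :=
    hM.matrix_det.mul (hM.matrix_updateRow p hv).matrix_det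
  filter_upwards [this.tendsto z |>.eventually (Ioi_mem_nhds h)] with y hy
  exact if_neg fun h' => lt_asymm (h' p hp) hy

theorem card_perm_fix_zero (n : ℕ) :
    (Finset.univ.filter fun σ : Equiv.Perm (Fin (n + 1)) => σ 0 = 0).card = n.factorial := by
  have h : (Finset.univ.filter fun σ : Equiv.Perm (Fin (n + 1)) => σ 0 = 0).card =
      (Finset.univ : Finset (Equiv.Perm (Fin n))).card := by
    refine Finset.card_nbij' (fun σ => (Equiv.Perm.decomposeFin σ).2)
      (fun τ => Equiv.Perm.decomposeFin.symm (0, τ)) ?_ ?_ ?_ ?_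
    · intro σ _; simp
    · intro τ _; simp
    · intro σ hσ
      have hσ : σ 0 = 0 := by simpa using hσ
      obtain ⟨⟨p, τ⟩, rfl⟩ := Equiv.Perm.decomposeFin.symm.surjective σ
      rw [Equiv.Perm.decomposeFin_symm_apply_zero] at hσ
      simp [hσ]
    · intro τ _; simp
  rw [h, Finset.card_univ, Fintype.card_perm, Fintype.card_fin]

theorem card_perms_fix_zero (m n : ℕ) :
    (Finset.univ.filter fun π : Fin m → Equiv.Perm (Fin (n + 1)) => ∀ j, π j 0 = 0).card =
      n.factorial ^ m := by
  have : (Finset.univ.filter fun π : Fin m → Equiv.Perm (Fin (n + 1)) => ∀ j, π j 0 = 0) =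
      Fintype.piFinset fun _ => Finset.univ.filter fun σ : Equiv.Perm (Fin (n + 1)) => σ 0 = 0 := by
    ext π; simp
  rw [this, Fintype.card_piFinset, Finset.prod_const, card_perm_fix_zero, Finset.card_univ,
    Fintype.card_fin]

/-- Only families fixing `0` in every block count, and there are `n! ^ m` of them. All contribute
the same sign, because `permSign π` also appears in the determinant and squares away. -/
theorem eventually_configDegree_concentrated (m n : ℕ) :
    ∃ e : ℤ, IsUnit e ∧
      ∀ᶠ z : (Fin m × Fin (n + 1) → Fin m × Fin (n + 1) → ℝ) × (Fin m × Fin (n + 1) → ℝ) in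
        𝓝 (concentrated m n, concentratedApex m n),
        configDegree z.1 z.2 = (n.factorial : ℤ) ^ m * e := by
  set D : ℝ := (configMatrix (permShift 1) (concentrated m n)).det with hD
  refine ⟨(SignType.sign D : ℤ), ?_, ?_⟩
  · rcases lt_or_gt_of_ne (det_configMatrix_concentrated_ne_zero (m := m) (n := n) 1) with h | h
    · rw [hD, sign_neg h]; simp
    · rw [hD, sign_pos h]; simp
  · have key : ∀ π : Fin m → Equiv.Perm (Fin (n + 1)),
        ∀ᶠ z : (Fin m × Fin (n + 1) → Fin m × Fin (n + 1) → ℝ) × (Fin m × Fin (n + 1) → ℝ) in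
          𝓝 (concentrated m n, concentratedApex m n),
          permSign π * coneSign (freeRows m n) (configMatrix (permShift π) z.1) z.2 =
            if ∀ j, π j 0 = 0 then (SignType.sign D : ℤ) else 0 := by
      intro π
      have hM : Continuous fun z : (Fin m × Fin (n + 1) → Fin m × Fin (n + 1) → ℝ) ×
          (Fin m × Fin (n + 1) → ℝ) => configMatrix (permShift π) z.1 :=
        (continuous_configMatrix _).comp continuous_fst
      have h0 := det_configMatrix_concentrated_ne_zero π
      have hdet : ∀ p, ((configMatrix (permShift π) (concentrated m n)).updateRow p
          (concentratedApex m n)).det = _ := fun p => by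
        rw [concentratedApex_eq_sum π, det_updateRow_sum, smul_eq_mul]
      have hsq : 0 < (configMatrix (permShift π) (concentrated m n)).det ^ 2 := by positivity
      by_cases hπ : ∀ j, π j 0 = 0
      · rw [if_pos hπ]
        have hs := eventually_coneSign_of_neg (S := freeRows m n) hM continuous_snd
          (z := (concentrated m n, concentratedApex m n)) h0 (by
            intro p hp
            rw [mem_freeRows] at hp
            simp only [hdet, hπ, if_true, if_neg hp]
            linarith)
        filter_upwards [hs] with z hz
        rw [hz]
        rw [configMatrix_concentrated_of_fix hπ, det_permute, ← hD, permSign,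
          Equiv.Perm.sign_prodCongrRight]
        rcases Int.units_eq_one_or (∏ j, Equiv.Perm.sign (π j)) with h1 | h1
        · simp [h1]
        · simp [h1, Left.sign_neg]
      · rw [if_neg hπ]
        push Not at hπ
        obtain ⟨j, hj⟩ := hπ
        obtain ⟨k, hk⟩ := (π j).surjective 0
        have hk0 : k ≠ 0 := by rintro rfl; exact hj hk
        have hs := eventually_coneSign_of_pos (S := freeRows m n) hM continuous_snd
          (z := (concentrated m n, concentratedApex m n)) (p := (j, k)) (by simpa using hk0) (by
            simp only [hdet, hj, hk, if_true, if_false]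
            linarith)
        filter_upwards [hs] with z hz
        rw [hz, mul_zero]
    filter_upwards [eventually_all.2 key] with z hz
    rw [configDegree, Finset.sum_congr rfl fun π _ => hz π, ← Finset.sum_filter,
      Finset.sum_const, card_perms_fix_zero, nsmul_eq_mul]
    push_cast
    rfl

/-! ### Generic configurations are dense -/

/-- On the line from `x` to `y` the determinant is a polynomial in `t`, nonzero at `t = 1`, hence
nonzero for some `t` arbitrarily close to `0`. -/
theorem dense_det_ne_zero_of_line {m n : ℕ} {Λ : Type*}
    {ℓ : Fin m × Fin (n + 1) → Λ} (s : Fin m × Fin (n + 1) → Fin (n + 1))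
    {y : Λ → Fin m × Fin (n + 1) → ℝ} (hy : (configMatrix s (y ∘ ℓ)).det ≠ 0) :
    Dense {x : Λ → Fin m × Fin (n + 1) → ℝ | (configMatrix s (x ∘ ℓ)).det ≠ 0} := by
  intro x
  set A := configMatrix s (x ∘ ℓ)
  set B := configMatrix s (y ∘ ℓ)
  set P : Polynomial ℝ :=
    (A.map Polynomial.C + (Polynomial.X : Polynomial ℝ) • (B - A).map Polynomial.C).det with hP
  have hev : ∀ t : ℝ, P.eval t = (configMatrix s ((x + t • (y - x)) ∘ ℓ)).det := by
    intro t
    rw [hP, ← Polynomial.coe_evalRingHom, RingHom.map_det]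
    congr 1
    ext q k
    by_cases h : q.2 = 0
    · simp [A, B, configMatrix, h]
    · simp [A, B, configMatrix, h, cyclicShift]
  have hP0 : P ≠ 0 := by
    intro h
    have := hev 1
    rw [h, Polynomial.eval_zero, one_smul, add_sub_cancel] at this
    exact hy this.symm
  have hd : Dense {t : ℝ | P.eval t ≠ 0} := by
    have hf : {t : ℝ | P.IsRoot t}.Finite := Polynomial.finite_setOfPred_isRoot hP0
    exact hf.countable.dense_compl ℝ
  have hc : Continuous fun t : ℝ => x + t • (y - x) := by fun_prop
  have := map_mem_closure hc (hd 0)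
    (t := {x | (configMatrix s (x ∘ ℓ)).det ≠ 0}) (fun t ht => by
      simpa only [Set.mem_ofPred_eq, ← hev] using ht)
  simpa using this

theorem exists_det_configMatrix_ne_zero {m n : ℕ} {Λ : Type*}
    {ℓ : Fin m × Fin (n + 1) → Λ} (hℓ : Function.Injective ℓ)
    (s : Fin m × Fin (n + 1) → Fin (n + 1)) :
    ∃ y : Λ → Fin m × Fin (n + 1) → ℝ, (configMatrix s (y ∘ ℓ)).det ≠ 0 := by
  -- Undoing the shift in advance makes each free row `q` the basis vector `q`.
  refine ⟨Function.extend ℓ (fun q => Pi.single (q.1, q.2 - s q) 1) 0, ?_⟩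
  rw [Function.extend_comp hℓ]
  convert det_configMatrix_concentrated_ne_zero (m := m) (n := n) 1 using 2
  ext ⟨j, k⟩ ⟨j', k'⟩
  by_cases hk : k = 0
  · simp [configMatrix, hk]
  · simp [configMatrix, hk, concentrated, cyclicShift_single, permShift]
    simp [cyclicShift, Pi.single_apply]

theorem dense_shiftGeneric (m n : ℕ) (Λ : Type*) [Finite Λ] :
    Dense {x : Λ → Fin m × Fin (n + 1) → ℝ | ShiftGeneric x} := by
  have : Fintype Λ := Fintype.ofFinite Λ
  have h := dense_iInter_of_isOpen
    (f := fun i : {ℓ : Fin m × Fin (n + 1) → Λ // Function.Injective ℓ} ×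
      (Fin m × Fin (n + 1) → Fin (n + 1)) =>
      {x : Λ → Fin m × Fin (n + 1) → ℝ | (configMatrix i.2 (x ∘ i.1.1)).det ≠ 0})
    (fun i => isOpen_ne_fun
      (((continuous_configMatrix i.2).comp (by fun_prop)).matrix_det) continuous_const)
    (fun i => by
      obtain ⟨y, hy⟩ := exists_det_configMatrix_ne_zero i.1.2 i.2
      exact dense_det_ne_zero_of_line i.2 hy)
  refine h.mono fun x hx ℓ hℓ s => ?_
  exact Set.mem_iInter.1 hx (⟨ℓ, hℓ⟩, s)

/-! ### Existence of a balanced combination -/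

/-- The convex combination with weights `w` of the shifted vectors of a configuration. -/
def weightedSum {m n : ℕ} (π : Fin m → Equiv.Perm (Fin (n + 1)))
    (x : Fin m × Fin (n + 1) → Fin m × Fin (n + 1) → ℝ) (v : Fin m × Fin (n + 1) → ℝ)
    (w : Option (Fin m × Fin (n + 1)) → ℝ) : Fin m × Fin (n + 1) → ℝ :=
  w none • v + ∑ q, w (some q) • cyclicShift (π q.1 q.2) (x q)

/-- The weights `w` are supported on the free rows and give a vector which is constant on
blocks. -/
def IsBalanced {m n : ℕ} (π : Fin m → Equiv.Perm (Fin (n + 1)))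
    (x : Fin m × Fin (n + 1) → Fin m × Fin (n + 1) → ℝ) (v : Fin m × Fin (n + 1) → ℝ)
    (w : Option (Fin m × Fin (n + 1)) → ℝ) : Prop :=
  (∀ j, w (some (j, 0)) = 0) ∧ ∀ j k, weightedSum π x v w (j, k) = weightedSum π x v w (j, 0)

/-- The weights range over a compact simplex, so projecting them away is a closed map. -/
theorem isClosed_exists_isBalanced {m n : ℕ} (π : Fin m → Equiv.Perm (Fin (n + 1))) :
    IsClosed {z : (Fin m × Fin (n + 1) → Fin m × Fin (n + 1) → ℝ) × (Fin m × Fin (n + 1) → ℝ) |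
      ∃ w ∈ stdSimplex ℝ (Option (Fin m × Fin (n + 1))), IsBalanced π z.1 z.2 w} := by
  have : CompactSpace (stdSimplex ℝ (Option (Fin m × Fin (n + 1)))) :=
    isCompact_iff_compactSpace.1 (isCompact_stdSimplex ℝ _)
  have hc : ∀ q, Continuous fun u : stdSimplex ℝ (Option (Fin m × Fin (n + 1))) ×
      ((Fin m × Fin (n + 1) → Fin m × Fin (n + 1) → ℝ) × (Fin m × Fin (n + 1) → ℝ)) =>
      weightedSum π u.2.1 u.2.2 u.1.1 q := by
    intro q
    have hw : ∀ o, Continuous fun u : stdSimplex ℝ (Option (Fin m × Fin (n + 1))) ×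
      ((Fin m × Fin (n + 1) → Fin m × Fin (n + 1) → ℝ) × (Fin m × Fin (n + 1) → ℝ)) =>
      u.1.1 o := fun o => (continuous_apply o).comp (continuous_subtype_val.comp continuous_fst)
    simp only [weightedSum, cyclicShift, Pi.add_apply, Pi.smul_apply, Finset.sum_apply,
      smul_eq_mul]
    refine ((hw _).mul (by fun_prop)).add (continuous_finsetSum _ fun p _ => ?_)
    exact (hw _).mul (by fun_prop)
  have hcl : IsClosed {u : stdSimplex ℝ (Option (Fin m × Fin (n + 1))) ×
      ((Fin m × Fin (n + 1) → Fin m × Fin (n + 1) → ℝ) × (Fin m × Fin (n + 1) → ℝ)) |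
      IsBalanced π u.2.1 u.2.2 u.1.1} := by
    simp only [IsBalanced, Set.ofPred_and, Set.ofPred_forall]
    refine (isClosed_iInter fun j => isClosed_eq
      ((continuous_apply _).comp (continuous_subtype_val.comp continuous_fst))
      continuous_const).inter
      (isClosed_iInter fun j => isClosed_iInter fun k => isClosed_eq (hc _) (hc _))
  convert isClosedMap_snd_of_compactSpace _ hcl using 1
  ext z
  constructor
  · rintro ⟨w, hw, h⟩
    exact ⟨(⟨w, hw⟩, z), h, rfl⟩
  · rintro ⟨⟨w, z'⟩, h, rfl⟩
    exact ⟨w.1, w.2, h⟩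

/-- The free coefficients `c q` of `v` are negative, so moving them to the side of `v` gives a
nonnegative combination in the span of the block indicators; it remains to normalize. -/
theorem exists_isBalanced_of_coneSign_ne_zero {m n : ℕ}
    {π : Fin m → Equiv.Perm (Fin (n + 1))}
    {x : Fin m × Fin (n + 1) → Fin m × Fin (n + 1) → ℝ} {v : Fin m × Fin (n + 1) → ℝ}
    (h : coneSign (freeRows m n) (configMatrix (permShift π) x) v ≠ 0) :
    ∃ w ∈ stdSimplex ℝ (Option (Fin m × Fin (n + 1))), IsBalanced π x v w := by
  have h0 : (configMatrix (permShift π) x).det ≠ 0 := by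
    intro h0; apply h; simp [coneSign, h0]
  obtain ⟨c, hc⟩ := exists_eq_sum_smul_row h0 v
  have hneg : ∀ p : Fin m × Fin (n + 1), p.2 ≠ 0 → c p < 0 := by
    rw [hc, coneSign_eq_of_eq_sum _ h0] at h
    by_contra h1
    apply h
    rw [if_neg]
    simpa only [mem_freeRows] using h1
  set u : Option (Fin m × Fin (n + 1)) → ℝ :=
    fun o => o.elim 1 fun q => if q.2 = 0 then 0 else - c q with hu
  have hu0 : ∀ o, 0 ≤ u o := by
    rintro (_ | q)
    · simp [hu]
    · by_cases hq : q.2 = 0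
      · simp [hu, hq]
      · simpa [hu, hq] using (hneg q hq).le
  have hpos : 0 < ∑ o, u o :=
    lt_of_lt_of_le (by simp [hu]) (Finset.single_le_sum (fun o _ => hu0 o) (Finset.mem_univ none))
  have hsum : ∀ j k, weightedSum π x v u (j, k) = c (j, 0) := by
    intro j k
    have h1 : weightedSum π x v u = ∑ q, if q.2 = 0 then c q • blockIndicator q.1 else 0 := by
      have : v = 1 • v := (one_smul _ _).symm
      simp only [weightedSum, hu, Option.elim, one_smul]
      conv_lhs => rw [hc]
      rw [← Finset.sum_add_distrib]
      refine Finset.sum_congr rfl fun q _ => ?_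
      by_cases hq : q.2 = 0
      · funext k; simp [hq, configMatrix]
      · funext k; simp [hq, configMatrix, permShift]
    rw [h1, Finset.sum_apply, Finset.sum_eq_single_of_mem (j, 0) (Finset.mem_univ _)]
    · simp [blockIndicator]
    · rintro ⟨j', k'⟩ _ hj
      by_cases hk : k' = 0
      · subst hk
        have : j ≠ j' := by rintro rfl; exact hj rfl
        simp [blockIndicator, this]
      · simp [hk]
  refine ⟨(∑ o, u o)⁻¹ • u, ⟨fun o => ?_, ?_⟩, fun j => ?_, fun j k => ?_⟩
  · exact mul_nonneg (inv_nonneg.2 hpos.le) (hu0 o)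
  · simp only [Pi.smul_apply, smul_eq_mul, ← Finset.mul_sum]
    exact inv_mul_cancel₀ hpos.ne'
  · simp [hu]
  · have : weightedSum π x v ((∑ o, u o)⁻¹ • u) = (∑ o, u o)⁻¹ • weightedSum π x v u := by
      simp only [weightedSum, Pi.smul_apply, smul_assoc, smul_add, Finset.smul_sum]
    rw [this, Pi.smul_apply, Pi.smul_apply, hsum, hsum]

/-- Both configurations belong to one generic family, so the hybrids are generic too: vectors are
exchanged one at a time, the apex last. -/
theorem ShiftGeneric.dvd_configDegree_sub {m n : ℕ}
    {ξ : Option (Fin (m + 1) × Fin (n + 1)) × Bool → Fin (m + 1) × Fin (n + 1) → ℝ}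
    (hξ : ShiftGeneric ξ) :
    ((n + 1 : ℕ) : ℤ) ∣ configDegree (fun q => ξ (some q, false)) (ξ (none, false)) -
      configDegree (fun q => ξ (some q, true)) (ξ (none, true)) := by
  set ℓ : Finset (Fin (m + 1) × Fin (n + 1)) → Fin (m + 1) × Fin (n + 1) →
    Option (Fin (m + 1) × Fin (n + 1)) × Bool := fun T q => (some q, decide (q ∈ T)) with hℓ
  have hinj : ∀ T, Function.Injective (ℓ T) := fun T q q' h => by
    simpa [hℓ] using congrArg Prod.fst h
  have hnone : ∀ T b, (none, b) ∉ Set.range (ℓ T) := by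
    rintro T b ⟨q, hq⟩
    simp [hℓ] at hq
  have hstep : ∀ T : Finset (Fin (m + 1) × Fin (n + 1)), ((n + 1 : ℕ) : ℤ) ∣
      configDegree (ξ ∘ ℓ ∅) (ξ (none, false)) - configDegree (ξ ∘ ℓ T) (ξ (none, false)) := by
    intro T
    induction T using Finset.induction_on with
    | empty => simp
    | insert p T hp ih =>
      have h1 : ℓ (insert p T) = Function.update (ℓ T) p (some p, true) := by
        funext q
        by_cases hq : q = p
        · subst hq; simp [hℓ]
        · simp [hℓ, hq]
      have h2 : (some p, true) ∉ Set.range (ℓ T) := by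
        rintro ⟨q, hq⟩
        simp only [hℓ, Prod.mk.injEq, Option.some.injEq, decide_eq_true_eq] at hq
        exact hp (hq.1 ▸ hq.2)
      rw [h1]
      have := hξ.configDegree_update (hinj T) h2 (hnone T false) (by simp) p
      simpa using ih.add this
  have h := hstep Finset.univ
  rw [hξ.configDegree_apex (hinj Finset.univ) (hnone _ true) (hnone _ false) (by simp)] at h
  simpa [hℓ, Function.comp_def] using h

theorem exists_isBalanced {m n : ℕ} (hn : (n + 1).Prime)
    (x : Fin (m + 1) × Fin (n + 1) → Fin (m + 1) × Fin (n + 1) → ℝ)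
    (v : Fin (m + 1) × Fin (n + 1) → ℝ) :
    ∃ π, ∃ w ∈ stdSimplex ℝ (Option (Fin (m + 1) × Fin (n + 1))), IsBalanced π x v w := by
  set Z : Set ((Fin (m + 1) × Fin (n + 1) → Fin (m + 1) × Fin (n + 1) → ℝ) ×
      (Fin (m + 1) × Fin (n + 1) → ℝ)) :=
    ⋃ π, {z | ∃ w ∈ stdSimplex ℝ (Option (Fin (m + 1) × Fin (n + 1))), IsBalanced π z.1 z.2 w}
    with hZ
  have hcl : IsClosed Z := isClosed_iUnion_of_finite isClosed_exists_isBalanced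
  suffices (x, v) ∈ Z by simpa [hZ] using this
  rw [← hcl.closure_eq, mem_closure_iff_nhds]
  intro U hU
  obtain ⟨e, he, hev⟩ := eventually_configDegree_concentrated (m + 1) n
  set pr : Bool → (Option (Fin (m + 1) × Fin (n + 1)) × Bool → Fin (m + 1) × Fin (n + 1) → ℝ) →
    (Fin (m + 1) × Fin (n + 1) → Fin (m + 1) × Fin (n + 1) → ℝ) ×
      (Fin (m + 1) × Fin (n + 1) → ℝ) :=
    fun b ξ => (fun q => ξ (some q, b), ξ (none, b)) with hpr
  have hprc : ∀ b, Continuous (pr b) := fun b => by simp only [hpr]; fun_prop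
  -- The given configuration and the concentrated one, to be perturbed simultaneously into a generic
  -- family.
  set ξ₀ : Option (Fin (m + 1) × Fin (n + 1)) × Bool → Fin (m + 1) × Fin (n + 1) → ℝ :=
    fun o => match o with
      | (some q, false) => x q
      | (none, false) => v
      | (some q, true) => concentrated (m + 1) n q
      | (none, true) => concentratedApex (m + 1) n
  have h1 : ∀ᶠ ξ in 𝓝 ξ₀, pr false ξ ∈ U := (hprc false).tendsto ξ₀ hU
  have h2 := ((hprc true).tendsto ξ₀).eventually hev
  obtain ⟨ξ, hgen, hξ1, hξ2⟩ := ((mem_closure_iff_frequently.1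
    (dense_shiftGeneric (m + 1) n _ ξ₀)).and_eventually (h1.and h2)).exists
  refine ⟨pr false ξ, hξ1, ?_⟩
  have hdvd := ShiftGeneric.dvd_configDegree_sub hgen
  have hne : configDegree (pr false ξ).1 (pr false ξ).2 ≠ 0 := by
    intro h0
    have h3 : ((n + 1 : ℕ) : ℤ) ∣ (n.factorial : ℤ) ^ (m + 1) * e := by
      rw [← hξ2]
      have := hdvd
      simp only [hpr] at h0 ⊢
      rw [h0, zero_sub, dvd_neg] at this
      exact this
    rw [he.dvd_mul_right] at h3
    have h4 := (Int.natCast_dvd_natCast (m := n + 1) (n := n.factorial ^ (m + 1))).1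
      (by exact_mod_cast h3)
    -- Primality enters here: a prime `n + 1` does not divide a power of `n!`.
    have := (hn.dvd_factorial).1 (hn.dvd_of_dvd_pow h4)
    omega
  obtain ⟨π, -, hπ⟩ := Finset.exists_ne_zero_of_sum_ne_zero hne
  exact Set.mem_iUnion.2 ⟨π, exists_isBalanced_of_coneSign_ne_zero (right_ne_zero_of_mul hπ)⟩

/-! ### The colored Tverberg theorem -/

/-- The coordinates of a point, preceded by `1`. -/
def homogenize {d : ℕ} (x : EuclideanSpace ℝ (Fin d)) : Fin (d + 1) → ℝ :=
  Fin.cons 1 fun t => x t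

/-- The vector with the homogenized point in the coordinates `(·, 0)`. -/
def homogenizedVec {d : ℕ} (n : ℕ) (x : EuclideanSpace ℝ (Fin d)) :
    Fin (d + 1) × Fin (n + 1) → ℝ :=
  fun q => if q.2 = 0 then homogenize x q.1 else 0

/-- Balance makes the weighted sums of homogenized points agree over all parts: coordinate `0` gives
equal total weights, the others equal centers of mass. -/
theorem exists_common_center {d n : ℕ} (hn : (n + 1).Prime)
    (pts : Option (Fin (d + 1) × Fin (n + 1)) → EuclideanSpace ℝ (Fin d)) :
    ∃ π : Fin (d + 1) → Equiv.Perm (Fin (n + 1)), ∃ y : EuclideanSpace ℝ (Fin d), ∀ i,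
      y ∈ convexHull ℝ (pts '' {o | o.elim (0 = i) fun q => q.2 ≠ 0 ∧ π q.1 q.2 = i}) := by
  obtain ⟨π, w, hw, hw0, hbal⟩ := exists_isBalanced hn
    (fun q => homogenizedVec n (pts (some q))) (homogenizedVec n (pts none))
  classical
  set T : Fin (n + 1) → Finset (Option (Fin (d + 1) × Fin (n + 1))) := fun i =>
    Finset.univ.filter fun o => o.elim (0 = i) fun q => q.2 ≠ 0 ∧ π q.1 q.2 = i with hT
  have hsum : ∀ j i, weightedSum π (fun q => homogenizedVec n (pts (some q)))
      (homogenizedVec n (pts none)) w (j, i) = ∑ o ∈ T i, w o * homogenize (pts o) j := by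
    intro j i
    rw [hT, Finset.sum_filter, Fintype.sum_option]
    simp only [weightedSum, Pi.add_apply, Finset.sum_apply, Pi.smul_apply, smul_eq_mul,
      homogenizedVec, cyclicShift, Option.elim]
    congr 1
    · simp [eq_comm]
    · refine Finset.sum_congr rfl fun q _ => ?_
      by_cases hq : q.2 = 0
      · have : w (some q) = 0 := by rw [← hw0 q.1, ← hq]
        simp [this]
      · simp [hq, sub_eq_zero, eq_comm (a := i)]
  have heq : ∀ j i, ∑ o ∈ T i, w o * homogenize (pts o) j =
      ∑ o ∈ T 0, w o * homogenize (pts o) j := by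
    intro j i
    rw [← hsum, ← hsum]; exact hbal j i
  have hW : ∀ i, ∑ o ∈ T i, w o = ∑ o ∈ T 0, w o := by
    intro i
    simpa [homogenize] using heq 0 i
  -- All parts have equal weight, so weight zero in one would make every `w o` zero, against total
  -- weight `1`.
  have hpos : 0 < ∑ o ∈ T 0, w o := by
    refine lt_of_le_of_ne (Finset.sum_nonneg fun o _ => hw.1 o) fun h0 => ?_
    have hz : ∀ o, w o = 0 := by
      intro o
      have hz' : ∀ i, ∀ o ∈ T i, w o = 0 := fun i =>
        (Finset.sum_eq_zero_iff_of_nonneg fun o _ => hw.1 o).1 ((hW i).trans h0.symm)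
      rcases o with _ | q
      · exact hz' 0 none (by simp [hT])
      · by_cases hq : q.2 = 0
        · rw [← hw0 q.1, ← hq]
        · exact hz' (π q.1 q.2) (some q) (by simp [hT, hq])
    have := hw.2
    simp [hz] at this
  refine ⟨π, (T 0).centerMass w pts, fun i => ?_⟩
  have hc : (T 0).centerMass w pts = (T i).centerMass w pts := by
    rw [Finset.centerMass, Finset.centerMass, hW i]
    congr 1
    ext t
    simpa [homogenize] using (heq t.succ i).symm
  rw [hc]
  refine Finset.centerMass_mem_convexHull _ (fun o _ => hw.1 o) (by rw [hW]; exact hpos) ?_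
  intro o ho
  exact Set.mem_image_of_mem _ (by simpa [hT] using ho)

theorem exists_injective_of_encard_eq {α : Type*} {s : Set α} {n : ℕ} (h : s.encard = n) :
    ∃ f : Fin n → α, Function.Injective f ∧ ∀ i, f i ∈ s := by
  have hfin : s.Finite := Set.finite_of_encard_eq_coe h
  have := hfin.to_subtype
  have hcard : Nat.card s = n := by
    rw [Nat.card_coe_set_eq, Set.ncard, h, ENat.toNat_natCast]
  let e := Finite.equivFinOfCardEq hcard
  exact ⟨fun i => e.symm i, Subtype.val_injective.comp e.symm.injective, fun i => (e.symm i).2⟩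

theorem theorem2 (d r : ℕ) (hd : 1 ≤ d) (hr : r.Prime)
    (C : Fin (d + 2) → Set (EuclideanSpace ℝ (Fin d))) (hC : IsBMZCollection d r C) :
    ∃ R : Fin r → Set (EuclideanSpace ℝ (Fin d)), IsRainbowPartition C R ∧ IsTverberg R := by
  obtain ⟨n, rfl⟩ : ∃ n, r = n + 1 := ⟨r - 1, (Nat.sub_add_cancel hr.one_le).symm⟩
  choose a ha_inj ha_mem using fun j => exists_injective_of_encard_eq (hC.encard_castSucc j)
  obtain ⟨c, hc⟩ := Set.encard_eq_one.1 hC.encard_last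
  -- The value `c` at indices `(j, 0)` is a filler; `P` below excludes these indices.
  set pts : Option (Fin (d + 1) × Fin (n + 1)) → EuclideanSpace ℝ (Fin d) :=
    fun o => o.elim c fun q => Fin.cases c (fun i => a q.1 i) q.2
  set color : Option (Fin (d + 1) × Fin (n + 1)) → Fin (d + 2) :=
    fun o => o.elim (Fin.last _) fun q => q.1.castSucc
  obtain ⟨π, y, hy⟩ := exists_common_center hr pts
  set P : Fin (n + 1) → Set (Option (Fin (d + 1) × Fin (n + 1))) :=
    fun i => {o | o.elim (0 = i) fun q => q.2 ≠ 0 ∧ π q.1 q.2 = i} with hP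
  have hmem : ∀ i, ∀ o ∈ P i, pts o ∈ C (color o) := by
    rintro i (_ | ⟨j, k⟩) ho
    · change c ∈ C (Fin.last _)
      rw [hc]; rfl
    · obtain ⟨k, rfl⟩ := Fin.exists_succ_eq.2 ho.1
      exact ha_mem j k
  have hcolor : ∀ i, ∀ o ∈ P i, ∀ j, pts o ∈ C j → color o = j := by
    intro i o ho j hj
    by_contra hne
    exact Set.disjoint_left.1 (hC.pairwise_disjoint hne) (hmem i o ho) hj
  have huniq : ∀ i, ∀ o ∈ P i, ∀ o' ∈ P i, color o = color o' → o = o' := by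
    rintro i (_ | ⟨j, k⟩) ho (_ | ⟨j', k'⟩) ho' h
    · rfl
    · exact absurd h.symm (Fin.castSucc_ne_last j')
    · exact absurd h (Fin.castSucc_ne_last j)
    · obtain rfl : j = j' := Fin.castSucc_injective _ h
      obtain rfl : k = k' := (π j).injective (ho.2.trans ho'.2.symm)
      rfl
  refine ⟨fun i => pts '' P i, ⟨fun i => ⟨?_, fun j => ?_⟩, fun i i' hii => ?_⟩, y, hy⟩
  · rintro _ ⟨o, ho, rfl⟩
    exact Set.mem_iUnion.2 ⟨_, hmem i o ho⟩
  · rw [Set.encard_le_one_iff]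
    rintro _ _ ⟨⟨o, ho, rfl⟩, hj⟩ ⟨⟨o', ho', rfl⟩, hj'⟩
    rw [huniq i o ho o' ho' ((hcolor i o ho j hj).trans (hcolor i o' ho' j hj').symm)]
  · refine Set.disjoint_left.2 ?_
    rintro _ ⟨o, ho, rfl⟩ ⟨o', ho', h⟩
    -- A shared point forces equal colors by disjointness of the classes, then equal indices by
    -- injectivity within a class, and an index lies in only one part.
    have hcol : color o = color o' := hcolor i o ho _ (h ▸ hmem i' o' ho')
    apply hii
    rcases o with _ | ⟨j, k⟩ <;> rcases o' with _ | ⟨j', k'⟩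
    · exact Eq.trans (Eq.symm ho) ho'
    · exact absurd hcol.symm (Fin.castSucc_ne_last j')
    · exact absurd hcol (Fin.castSucc_ne_last j)
    · obtain rfl : j = j' := Fin.castSucc_injective _ hcol
      obtain ⟨k, rfl⟩ := Fin.exists_succ_eq.2 ho.1
      obtain ⟨k', rfl⟩ := Fin.exists_succ_eq.2 ho'.1
      obtain rfl : k' = k := ha_inj j h
      exact ho.2.symm.trans ho'.2
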